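/- Fix a finite alphabet $A$. A class $\mathcal{C}$ of languages over $A$ (a set of subsets of $A^*$) is a quotienting lattice of regular languages if all its members are regular, $\emptyset, A^* \in \mathcal{C}$, and $\mathcal{C}$ is closed under union, intersection, and the left and right quotients $u^{-1}L = \{w \in A^* \mid uw \in L\}$ and $Lu^{-1} = \{w \in A^* \mid wu \in L\}$ for all $u \in A^*$. The polynomial closure $\mathrm{Pol}(\mathcal{C})$ is the smallest class of languages over $A$ that contains $\mathcal{C}$ and is closed under union and under marked concatenation: $H \cup L$ and $HaL = \{uav \mid u \in H,\ v \in L\}$ belong to $\mathrm{Pol}(\mathcal{C})$ for all $H, L \in \mathrm{Pol}(\mathcal{C})$ and $a \in A$. For a class $\mathcal{D}$, the $\mathcal{D}$-membership problem takes as input a regular language $L \subseteq A^*$ and asks whether $L \in \mathcal{D}$. The $\mathcal{D}$-separation problem takes as input two regular languages $L_1, L_2 \subseteq A^*$ and asks whether there is $K \in \mathcal{D}$ with $L_1 \subseteq K$ and $L_2 \cap K = \emptyset$. In both problems, regular languages are given by nondeterministic finite automata. **Theorem.** Let $\mathcal{C}$ be a quotienting lattice of regular languages over $A$. If $\mathcal{C}$-separation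 is decidable, then $\mathrm{Pol}(\mathcal{C})$-membership is decidable. -/

import Mathlib

namespace PolClosure

variable {A : Type*}

/-- The right quotient `L u⁻¹ = {w | w u ∈ L}`
(the left quotient `u⁻¹ L` is `Language.leftQuotient`). -/
def rightQuotient (L : Language A) (u : List A) : Language A := {w | w ++ u ∈ L}

/-- A quotienting lattice of regular languages over `A`. -/
structure IsQuotientingLattice (C : Set (Language A)) : Prop where
  regular : ∀ L ∈ C, L.IsRegular
  empty_mem : (⊥ : Language A) ∈ C
  univ_mem : (⊤ : Language A) ∈ C
  union_mem : ∀ K ∈ C, ∀ L ∈ C, K ⊔ L ∈ C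
  inter_mem : ∀ K ∈ C, ∀ L ∈ C, K ⊓ L ∈ C
  leftQuotient_mem : ∀ L ∈ C, ∀ u : List A, L.leftQuotient u ∈ C
  rightQuotient_mem : ∀ L ∈ C, ∀ u : List A, rightQuotient L u ∈ C

/-- Membership in the polynomial closure of `C`, generated from `C` by union and by marked
concatenation `H, L ↦ H a L`, for every letter `a`. -/
inductive InPol (C : Set (Language A)) : Language A → Prop
  | basic {L : Language A} (hL : L ∈ C) : InPol C L
  | union {H L : Language A} (hH : InPol C H) (hL : InPol C L) : InPol C (H ⊔ L)
  | marked {H L : Language A} (a : A) (hH : InPol C H) (hL : InPol C L) :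
      InPol C (H * {[a]} * L)

/-- The polynomial closure of `C`: the smallest class of languages containing `C` and closed under
union and under marked concatenation. -/
def Pol (C : Set (Language A)) : Set (Language A) := {L | InPol C L}

/-- `K` separates `L₁` from `L₂`. -/
def Separates (K L₁ L₂ : Language A) : Prop := L₁ ≤ K ∧ L₂ ⊓ K = ⊥

/-- `L₁` is `C`-separable from `L₂`. -/
def Separable (C : Set (Language A)) (L₁ L₂ : Language A) : Prop :=
  ∃ K ∈ C, Separates K L₁ L₂

/-- A nondeterministic finite automaton over `A`, as a finite object that an algorithm can take as
input: the list of initial states, the list of transitions `(p, a, q)` and the list of final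
states. States are named by natural numbers. -/
abbrev Automaton (A : Type*) : Type _ := List ℕ × List (ℕ × A × ℕ) × List ℕ

namespace Automaton

/-- The automaton written down by `M`. -/
def toNFA (M : Automaton A) : NFA A ℕ where
  step p a := {q | (p, a, q) ∈ M.2.1}
  start := {q | q ∈ M.1}
  accept := {q | q ∈ M.2.2}

/-- The language accepted by `M`. -/
def language (M : Automaton A) : Language A := M.toNFA.accepts

end Automaton

/-- `C`-membership is decidable: some algorithm takes (an automaton for) a regular language `L` and
decides whether `L ∈ C`. -/
def MembershipDecidable [Primcodable A] (C : Set (Language A)) : Prop :=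
  ComputablePred fun M : Automaton A => M.language ∈ C

/-- `C`-separation is decidable: some algorithm takes (automata for) regular languages `L₁`, `L₂`
and decides whether `L₁` is `C`-separable from `L₂`. -/
def SeparationDecidable [Primcodable A] (C : Set (Language A)) : Prop :=
  ComputablePred fun M : Automaton A × Automaton A => Separable C M.1.language M.2.language

/-- Over a finite alphabet, the languages accepted by the automata above are exactly the regular
languages. -/
theorem isRegular_iff_exists_automaton [Finite A] (L : Language A) :
    L.IsRegular ↔ ∃ M : Automaton A, M.language = L := by
  constructor
  · rintro ⟨σ, _, D, rfl⟩
    have := Fintype.ofFinite A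
    classical
    let e : σ ≃ Fin (Fintype.card σ) := Fintype.equivFin σ
    have hinj : ∀ s t : σ, (e s : ℕ) = e t ↔ s = t := fun s t => by
      rw [← Fin.ext_iff, e.apply_eq_iff_eq]
    let M : Automaton A := ([(e D.start : ℕ)],
      (Finset.univ : Finset (σ × A)).toList.map
        (fun x => ((e x.1 : ℕ), x.2, (e (D.step x.1 x.2) : ℕ))),
      ((Finset.univ : Finset σ).toList.filter (· ∈ D.accept)).map (fun s => (e s : ℕ)))
    refine ⟨M, ?_⟩
    have hstep : ∀ s a, M.toNFA.stepSet {(e s : ℕ)} a = {(e (D.step s a) : ℕ)} := by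
      intro s a
      ext q
      simp only [NFA.stepSet_singleton, Set.mem_singleton_iff]
      simp only [Automaton.toNFA, M, Set.mem_ofPred_eq, List.mem_map, Finset.mem_toList,
        Finset.mem_univ, true_and, Prod.mk.injEq, Prod.exists, hinj]
      constructor
      · rintro ⟨s', a', rfl, rfl, h⟩
        exact h.symm
      · rintro rfl
        exact ⟨s, a, rfl, rfl, rfl⟩
    have heval : ∀ (w : List A) (s : σ),
        M.toNFA.evalFrom {(e s : ℕ)} w = {(e (D.evalFrom s w) : ℕ)} := by
      intro w
      induction w with
      | nil => intro s; rfl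
      | cons a w ih => intro s; rw [NFA.evalFrom_cons, hstep, ih, DFA.evalFrom_cons]
    have hstart : M.toNFA.start = {(e D.start : ℕ)} := by
      ext q; simp [Automaton.toNFA, M]
    ext w
    change (∃ s ∈ M.toNFA.accept, s ∈ M.toNFA.evalFrom M.toNFA.start w) ↔
      D.evalFrom D.start w ∈ D.accept
    rw [hstart, heval]
    simp [Automaton.toNFA, M, hinj]
  · rintro ⟨M, rfl⟩
    apply Language.IsRegular.of_finite_range_leftQuotient
    let F : Set ℕ := {q | q ∈ M.1} ∪ {q | q ∈ M.2.1.map fun t => t.2.2}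
    have hF : F.Finite := (List.finite_toSet _).union (List.finite_toSet _)
    have hsub : ∀ (w : List A) (S : Set ℕ), S ⊆ F → M.toNFA.evalFrom S w ⊆ F := by
      intro w
      induction w with
      | nil => intro S hS; exact hS
      | cons a w ih =>
        intro S _
        refine ih _ fun q hq => ?_
        obtain ⟨p, _, hp⟩ := NFA.mem_stepSet.1 hq
        exact Or.inr (List.mem_map.2 ⟨(p, a, q), hp, rfl⟩)
    refine (hF.finite_subsets.image M.toNFA.acceptsFrom).subset ?_
    rintro _ ⟨w, rfl⟩
    refine ⟨M.toNFA.evalFrom M.toNFA.start w, hsub w _ fun q hq => Or.inl hq, ?_⟩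
    ext v
    exact (NFA.append_mem_acceptsFrom M.toNFA).symm

end PolClosure

/-!
Let `α` be a morphism from words to a finite monoid that recognizes `L`. Then `L ∈ Pol C` if and
only if `e ≤ e t e` in the syntactic preorder of `L`, for all `e` and `t` such that `e` is
idempotent and the fiber of `e` is not `C`-separable from the fiber of `t`.

For necessity, only finitely many languages of `C` matter for a given language of `Pol C`. As the
fibers are inseparable, they contain words `u` and `v` such that `v` belongs to each of these
languages that contains `u`. In a large power of `u` one can then insert `v`.

For sufficiency, the sets of words that can be covered, fiber by fiber, by languages of `Pol C`
going up in the syntactic preorder are closed under unions and products. The criterion makes them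
closed under the iteration of a set of words with the same idempotent image `e`: all the words
between the first and the last factor are covered by a language of `C` whose words `t` satisfy
`e ≤ e t e`. As in the factorization forest theorem, the set of all words is obtained from the
letters by these operations.

For the transition morphism of an automaton, the criterion asks finitely many questions on the
separation of fibers, and automata for the fibers can be computed.
-/

namespace PolClosure

open scoped Pointwise

section IterationIdeal

variable {W M : Type*} [Monoid W] [Monoid M]

/-- A family of subsets of `W` that is closed under subsets, finite unions, products, and submonoids
generated by those members that `α` maps to a single idempotent. By the factorization forest theorem
in the form of `IsIterationIdeal.closure_mem`, the last closure property then holds without the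
restriction on `α`. -/
structure IsIterationIdeal (α : W →* M) (G : Set (Set W)) : Prop where
  mono : ∀ {X Y : Set W}, X ∈ G → Y ⊆ X → Y ∈ G
  one_mem : 1 ∈ G
  union : ∀ {X Y : Set W}, X ∈ G → Y ∈ G → X ∪ Y ∈ G
  mul : ∀ {X Y : Set W}, X ∈ G → Y ∈ G → X * Y ∈ G
  iterate : ∀ {X : Set W} {e : M}, X ∈ G → IsIdempotentElem e → (∀ x ∈ X, α x = e) →
    (Submonoid.closure X : Set W) ∈ G

/-- `CayleyPath α X T g w` says that `w` is a nonempty product of elements of `X` such that the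
corresponding path from `g` in the right Cayley graph of `M` has all its inner vertices in `T`. The
two ends of the path need not belong to `T`. -/
inductive CayleyPath (α : W →* M) (X : Set W) (T : Set M) (g : M) : W → Prop
  | single {x : W} (hx : x ∈ X) : CayleyPath α X T g x
  | snoc {w x : W} (hw : CayleyPath α X T g w) (hT : g * α w ∈ T) (hx : x ∈ X) :
      CayleyPath α X T g (w * x)

/-- The submonoid of the elements that fix `s` under multiplication on the right. -/
def rightStabilizer (s : M) : Submonoid M where
  carrier := {z | s * z = s}
  one_mem' := mul_one s
  mul_mem' {a b} (ha : s * a = s) (hb : s * b = s) := by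
    change s * (a * b) = s
    rw [← mul_assoc, ha, hb]

theorem mem_rightStabilizer {s z : M} : z ∈ rightStabilizer s ↔ s * z = s := Iff.rfl

variable {α : W →* M} {X : Set W} {T : Set M} {g s : M} {w : W}

theorem map_mem_of_mem_closure {S : Submonoid M} (hX : ∀ x ∈ X, α x ∈ S)
    (hw : w ∈ Submonoid.closure X) : α w ∈ S :=
  (Submonoid.closure_le (S := S.comap α)).2 hX hw

theorem closure_union_subset (B C : Set W) :
    (Submonoid.closure (B ∪ C) : Set W) ⊆
      Submonoid.closure B * Submonoid.closure (C * (Submonoid.closure B : Set W)) := by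
  intro w hw
  induction hw using Submonoid.closure_induction_left with
  | one => exact ⟨1, one_mem _, 1, one_mem _, mul_one 1⟩
  | mul_left x hx y _ ih =>
    obtain ⟨b, hb, z, hz, rfl⟩ := ih
    rcases hx with hx | hx
    · exact ⟨x * b, mul_mem (Submonoid.subset_closure hx) hb, z, hz, mul_assoc _ _ _⟩
    · have hxb : x * b ∈ C * (Submonoid.closure B : Set W) := ⟨x, hx, b, hb, rfl⟩
      refine ⟨1, one_mem _, x * b * z, mul_mem (Submonoid.subset_closure hxb) hz, ?_⟩
      simp only [one_mul, mul_assoc]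

theorem closure_subset_of_map_eq {e : M} (he : IsIdempotentElem e) (hX : ∀ x ∈ X, α x = e) :
    (Submonoid.closure X : Set W) ⊆ 1 ∪ X ∪ X * X ∪ X * α ⁻¹' {e} * X := by
  intro w hw
  induction hw using Submonoid.closure_induction_right with
  | one => exact Or.inl (Or.inl (Or.inl rfl))
  | mul_right w _ x hx ih =>
    rcases ih with ((rfl | hw) | ⟨y, hy, z, hz, rfl⟩) | ⟨_, ⟨y, hy, t, ht, rfl⟩, z, hz, rfl⟩
    · exact Or.inl (Or.inl (Or.inr (by simpa using hx)))
    · exact Or.inl (Or.inr ⟨w, hw, x, hx, rfl⟩)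
    · exact Or.inr ⟨y * z, ⟨y, hy, z, hX z hz, rfl⟩, x, hx, rfl⟩
    · have htz : α (t * z) = e := by rw [map_mul, ht, hX z hz, he.eq]
      exact Or.inr ⟨y * (t * z), ⟨y, hy, t * z, htz, rfl⟩, x, hx, by simp only [mul_assoc]⟩

namespace CayleyPath

theorem mem_closure (hw : CayleyPath α X T g w) : w ∈ Submonoid.closure X := by
  induction hw with
  | single hx => exact Submonoid.subset_closure hx
  | snoc _ _ hx ih => exact mul_mem ih (Submonoid.subset_closure hx)

theorem exists_of_insert (hw : CayleyPath α X (insert s T) g w) :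
    CayleyPath α X T g w ∨ ∃ a l b, CayleyPath α X T g a ∧ g * α a = s ∧
      l ∈ Submonoid.closure {y | CayleyPath α X T s y ∧ s * α y = s} ∧
      CayleyPath α X T s b ∧ w = a * l * b := by
  induction hw with
  | single hx => exact Or.inl (.single hx)
  | @snoc w x hw hT hx ih =>
    rcases ih with h | ⟨a, l, b, ha, has, hl, hb, rfl⟩
    · rcases hT with hT | hT
      · exact Or.inr ⟨w, 1, x, h, hT, one_mem _, .single hx, by rw [mul_one]⟩
      · exact Or.inl (.snoc h hT hx)
    · have hls : s * α l = s :=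
        map_mem_of_mem_closure (S := rightStabilizer s) (fun _ hy => hy.2) hl
      rw [map_mul, map_mul, ← mul_assoc, ← mul_assoc, has, hls] at hT
      rcases hT with hT | hT
      · exact Or.inr ⟨a, l * b, x, ha, has, mul_mem hl (Submonoid.subset_closure ⟨hb, hT⟩),
          .single hx, by simp only [mul_assoc]⟩
      · exact Or.inr ⟨a, l, b * x, ha, has, hl, .snoc hb hT hx, by simp only [mul_assoc]⟩

end CayleyPath

theorem closure_subset_closure_cayleyPath_mul (α : W →* M) (X : Set W) (T : Set M) :
    (Submonoid.closure X : Set W) ⊆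
      Submonoid.closure {w | CayleyPath α X T 1 w ∧ α w ∉ T} *
        (1 ∪ {w | CayleyPath α X T 1 w}) := by
  intro w hw
  induction hw using Submonoid.closure_induction_right with
  | one => exact ⟨1, one_mem _, 1, Or.inl rfl, mul_one 1⟩
  | mul_right w _ x hx ih =>
    obtain ⟨l, hl, b, rfl | hb, rfl⟩ := ih
    · exact ⟨l, hl, x, Or.inr (.single hx), by simp only [mul_one]⟩
    by_cases hbT : α b ∈ T
    · exact ⟨l, hl, b * x, Or.inr (.snoc hb (by rwa [one_mul]) hx), (mul_assoc _ _ _).symm⟩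
    · exact ⟨l * b, mul_mem hl (Submonoid.subset_closure ⟨hb, hbT⟩), x, Or.inr (.single hx), rfl⟩

namespace IsIterationIdeal

variable {G : Set (Set W)}

theorem iUnion_mem (hG : IsIterationIdeal α G) {ι : Type*} [Finite ι] {f : ι → Set W}
    (hf : ∀ i, f i ∈ G) : ⋃ i, f i ∈ G := by
  have hsup : SupClosed G := fun _ hX _ hY => hG.union hX hY
  exact hsup.iSup_mem (hG.mono hG.one_mem (Set.empty_subset _)) hf

theorem setOf_cayleyPath_mem (hG : IsIterationIdeal α G) (hX : X ∈ G) (hT : T.Finite)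
    (hloop : ∀ s ∈ T, ∀ Y ∈ G, (∀ y ∈ Y, y ∈ Submonoid.closure X ∧ s * α y = s) →
      (Submonoid.closure Y : Set W) ∈ G) (g : M) :
    {w | CayleyPath α X T g w} ∈ G := by
  induction T, hT using Set.Finite.induction_on generalizing g with
  | empty =>
    refine hG.mono hX fun w hw => ?_
    cases hw with
    | single hx => exact hx
    | snoc _ h _ => exact h.elim
  | @insert s T _ _ ih =>
    have paths (g : M) : {w | CayleyPath α X T g w} ∈ G :=
      ih (fun t ht => hloop t (Set.mem_insert_of_mem s ht)) g
    have loops : (Submonoid.closure {y | CayleyPath α X T s y ∧ s * α y = s} : Set W) ∈ G :=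
      hloop s (Set.mem_insert s T) _ (hG.mono (paths s) fun _ hy => hy.1)
        fun _ hy => ⟨hy.1.mem_closure, hy.2⟩
    refine hG.mono (hG.union (paths g) (hG.mul (hG.mul (paths g) loops) (paths s))) fun w hw => ?_
    rcases CayleyPath.exists_of_insert hw with h | ⟨a, l, b, ha, -, hl, hb, rfl⟩
    · exact Or.inl h
    · exact Or.inr ⟨a * l, ⟨a, ha, l, hl, rfl⟩, b, hb, rfl⟩

theorem closure_mem_of_map_mul_map_eq_left (hG : IsIterationIdeal α G) (hX : X ∈ G)
    (hfin : (α '' X).Finite) (hleft : ∀ x ∈ X, ∀ y ∈ X, α x * α y = α x) :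
    (Submonoid.closure X : Set W) ∈ G := by
  suffices h : (Submonoid.closure {x ∈ X | α x ∈ α '' X} : Set W) ∈ G from
    hG.mono h (Submonoid.closure_mono fun x hx => ⟨hx, x, hx, rfl⟩)
  refine hfin.induction_on_subset _
    (motive := fun Z _ => (Submonoid.closure {x ∈ X | α x ∈ Z} : Set W) ∈ G) ?_ ?_
  · exact hG.mono hG.one_mem (by simp)
  · rintro _ Z ⟨x, hx, rfl⟩ - - ih
    have hfiber : {y ∈ X | α y = α x} * (Submonoid.closure {y ∈ X | α y ∈ Z} : Set W) ∈ G :=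
      hG.mul (hG.mono hX fun _ hy => hy.1) ih
    refine hG.mono (hG.mul ih (hG.iterate hfiber (hleft x hx x hx) ?_)) ?_
    · rintro _ ⟨y, hy, b, hb, rfl⟩
      rw [map_mul, hy.2]
      exact map_mem_of_mem_closure (S := rightStabilizer (α x)) (fun z hz => hleft x hx z hz.1) hb
    · refine subset_trans (SetLike.coe_subset_coe.2 (Submonoid.closure_mono ?_))
        (closure_union_subset _ _)
      rintro y ⟨hy, hyx | hyZ⟩
      exacts [Or.inr ⟨hy, hyx⟩, Or.inl ⟨hy, hyZ⟩]

theorem closure_mem_of_map_mem [Finite M] (hG : IsIterationIdeal α G) (S : Submonoid M)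
    (hX : X ∈ G) (hXS : ∀ x ∈ X, α x ∈ S) : (Submonoid.closure X : Set W) ∈ G := by
  induction S using WellFoundedLT.induction generalizing X with
  | ind S ih =>
  -- An element of `S` is either a left zero of `S` or has a smaller stabilizer in `S`.
  let T : Set M := {s | ∃ r ∈ S, s * r ≠ s}
  have hloop : ∀ s ∈ T, ∀ Y ∈ G, (∀ y ∈ Y, y ∈ Submonoid.closure X ∧ s * α y = s) →
      (Submonoid.closure Y : Set W) ∈ G := by
    rintro s ⟨r, hr, hsr⟩ Y hY hYs
    have hlt : S ⊓ rightStabilizer s < S :=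
      inf_lt_left.2 fun hle => hsr (mem_rightStabilizer.1 (hle hr))
    exact ih _ hlt hY fun y hy => ⟨map_mem_of_mem_closure hXS (hYs y hy).1, (hYs y hy).2⟩
  have hpaths : {w | CayleyPath α X T 1 w} ∈ G :=
    hG.setOf_cayleyPath_mem hX (Set.toFinite T) hloop 1
  have hblocks : (Submonoid.closure {w | CayleyPath α X T 1 w ∧ α w ∉ T} : Set W) ∈ G := by
    refine hG.closure_mem_of_map_mul_map_eq_left (hG.mono hpaths fun _ hw => hw.1)
      (Set.toFinite _) fun v hv w hw => ?_
    by_contra hne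
    exact hv.2 ⟨α w, map_mem_of_mem_closure hXS hw.1.mem_closure, hne⟩
  exact hG.mono (hG.mul hblocks (hG.union hG.one_mem hpaths))
    (closure_subset_closure_cayleyPath_mul α X T)

theorem closure_mem [Finite M] (hG : IsIterationIdeal α G) (hX : X ∈ G) :
    (Submonoid.closure X : Set W) ∈ G :=
  hG.closure_mem_of_map_mem ⊤ hX fun _ _ => Submonoid.mem_top _

end IsIterationIdeal

end IterationIdeal

section PolynomialClosure

variable {C : Set (Language A)} {H L : Language A}

theorem mem_marked {a : A} {w : List A} :
    w ∈ H * {[a]} * L ↔ ∃ h ∈ H, ∃ l ∈ L, w = h ++ a :: l := by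
  simp only [Language.mem_mul]
  constructor
  · rintro ⟨_, ⟨h, hh, b, hb, rfl⟩, l, hl, rfl⟩
    obtain rfl : b = [a] := hb
    exact ⟨h, hh, l, hl, by simp⟩
  · rintro ⟨h, hh, l, hl, rfl⟩
    exact ⟨h ++ [a], ⟨h, hh, [a], rfl, rfl⟩, l, hl, by simp⟩

theorem append_mem_marked {a : A} {x y : List A} :
    x ++ y ∈ H * {[a]} * L ↔
      (∃ z t, x ++ z ∈ H ∧ t ∈ L ∧ y = z ++ a :: t) ∨
        ∃ s z, s ∈ H ∧ z ++ y ∈ L ∧ x = s ++ a :: z := by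
  rw [mem_marked]
  constructor
  · rintro ⟨h, hh, l, hl, hxy⟩
    rcases List.append_eq_append_iff.1 hxy with ⟨z, rfl, rfl⟩ | ⟨z, rfl, hz⟩
    · exact Or.inl ⟨z, l, hh, hl, rfl⟩
    · rcases List.cons_eq_append_iff.1 hz with ⟨rfl, rfl⟩ | ⟨z, rfl, rfl⟩
      · exact Or.inl ⟨[], l, by simpa using hh, hl, rfl⟩
      · exact Or.inr ⟨h, z, hh, hl, rfl⟩
  · rintro (⟨z, t, hz, ht, rfl⟩ | ⟨s, z, hs, hz, rfl⟩)
    · exact ⟨x ++ z, hz, t, ht, by simp⟩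
    · exact ⟨s, hs, z ++ y, hz, by simp⟩

theorem leftQuotient_singleton_marked (a b : A) :
    (H * {[a]} * L).leftQuotient [b] =
      H.leftQuotient [b] * {[a]} * L ⊔ ⨆ _ : [] ∈ H ∧ b = a, L := by
  ext w
  change [b] ++ w ∈ H * {[a]} * L ↔ w ∈ H.leftQuotient [b] * {[a]} * L ∨ w ∈ ⨆ _, L
  rw [append_mem_marked, mem_marked, Language.mem_iSup]
  refine or_congr ?_ ?_
  · simp only [Language.mem_leftQuotient, exists_and_left]
  · constructor
    · rintro ⟨_ | ⟨c, s⟩, z, hs, hz, h⟩ <;> simp_all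
    · rintro ⟨⟨hH, rfl⟩, hw⟩
      exact ⟨[], [], hH, hw, rfl⟩

theorem mul_eq_iSup_marked (H L : Language A) :
    H * L = (⨆ a, H * {[a]} * L.leftQuotient [a]) ⊔ ⨆ _ : [] ∈ L, H := by
  ext w
  change w ∈ H * L ↔ w ∈ (⨆ a, H * {[a]} * L.leftQuotient [a]) ∨ w ∈ ⨆ _, H
  rw [Language.mem_mul, Language.mem_iSup, Language.mem_iSup]
  simp only [mem_marked, Language.mem_leftQuotient]
  constructor
  · rintro ⟨h, hh, _ | ⟨a, l⟩, hl, rfl⟩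
    · exact Or.inr ⟨hl, by simpa using hh⟩
    · exact Or.inl ⟨a, h, hh, l, hl, rfl⟩
  · rintro (⟨a, h, hh, l, hl, rfl⟩ | ⟨hnil, hw⟩)
    · exact ⟨h, hh, a :: l, hl, rfl⟩
    · exact ⟨w, hw, [], hnil, List.append_nil w⟩

theorem mem_iInf {ι : Sort*} {f : ι → Language A} {w : List A} : w ∈ ⨅ i, f i ↔ ∀ i, w ∈ f i :=
  Set.mem_iInter

namespace IsQuotientingLattice

theorem iSup_mem (hC : IsQuotientingLattice C) {ι : Sort*} [Finite ι] {f : ι → Language A}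
    (hf : ∀ i, f i ∈ C) : ⨆ i, f i ∈ C :=
  have hsup : SupClosed C := fun K hK L hL => hC.union_mem K hK L hL
  hsup.iSup_mem hC.empty_mem hf

theorem iInf_mem (hC : IsQuotientingLattice C) {ι : Sort*} [Finite ι] {f : ι → Language A}
    (hf : ∀ i, f i ∈ C) : ⨅ i, f i ∈ C :=
  have hinf : InfClosed C := fun K hK L hL => hC.inter_mem K hK L hL
  hinf.iInf_mem hC.univ_mem hf

end IsQuotientingLattice

namespace InPol

theorem iSup (hC : IsQuotientingLattice C) {ι : Sort*} [Finite ι] {f : ι → Language A}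
    (hf : ∀ i, InPol C (f i)) : InPol C (⨆ i, f i) :=
  have hsup : SupClosed (Pol C) := fun _ hH _ hL => .union hH hL
  hsup.iSup_mem (.basic hC.empty_mem) hf

theorem leftQuotient_singleton (hC : IsQuotientingLattice C) (hL : InPol C L) (b : A) :
    InPol C (L.leftQuotient [b]) := by
  induction hL with
  | basic hL => exact .basic (hC.leftQuotient_mem _ hL _)
  | union _ _ ihH ihL => exact .union ihH ihL
  | marked a _ hL ihH _ =>
    rw [leftQuotient_singleton_marked]
    exact .union (.marked a ihH hL) (iSup hC fun _ => hL)

theorem mul [Finite A] (hC : IsQuotientingLattice C) (hH : InPol C H) (hL : InPol C L) :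
    InPol C (H * L) := by
  rw [mul_eq_iSup_marked]
  exact .union (iSup hC fun a => .marked a hH (leftQuotient_singleton hC hL a))
    (iSup hC fun _ => hH)

end InPol

end PolynomialClosure

section Criterion

/-- The syntactic preorder of `L`. -/
def SyntacticLE (L : Language A) (u v : List A) : Prop :=
  ∀ x y, x ++ u ++ y ∈ L → x ++ v ++ y ∈ L

namespace SyntacticLE

variable {L : Language A} {u v w u' v' : List A}

theorem refl (L : Language A) (u : List A) : SyntacticLE L u u := fun _ _ => id

theorem trans (h : SyntacticLE L u v) (h' : SyntacticLE L v w) : SyntacticLE L u w :=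
  fun x y hu => h' x y (h x y hu)

theorem mem (h : SyntacticLE L u v) (hu : u ∈ L) : v ∈ L := by
  simpa using h [] [] (by simpa using hu)

theorem append (h : SyntacticLE L u u') (h' : SyntacticLE L v v') :
    SyntacticLE L (u ++ v) (u' ++ v') := by
  intro x y hu
  have h₁ : x ++ u' ++ (v ++ y) ∈ L := h x (v ++ y) (by simpa using hu)
  have h₂ : x ++ u' ++ v' ++ y ∈ L := h' (x ++ u') y (by simpa using h₁)
  simpa using h₂

end SyntacticLE

variable {M : Type*} [Monoid M] (α : FreeMonoid A →* M)

theorem map_append (u v : List A) : α (u ++ v : List A) = α u * α v := α.map_mul u v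

/-- The language of the words that `α` maps to `m`. Words are lists, which is what the free monoid
unfolds to. -/
def fiber (m : M) : Language A := {w | α w = m}

/-- The morphism `α` recognizes `L` if `L` is a union of fibers of `α`. -/
def Recognizes (L : Language A) : Prop := ∀ u v : List A, α u = α v → u ∈ L → v ∈ L

/-- The condition on a morphism recognizing `L` that characterizes membership of `L` in the
polynomial closure of `C`: every `C`-inseparable pair `(e, t)` with `e` idempotent satisfies
`e ≤ e t e` in the syntactic preorder of `L`. Elements of the monoid are represented by words. -/
def PolCriterion (C : Set (Language A)) (L : Language A) : Prop :=
  ∀ u v : List A, IsIdempotentElem (α u) → ¬Separable C (fiber α (α u)) (fiber α (α v)) →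
    SyntacticLE L u (u ++ v ++ u)

/-- The sets `X` of words such that, for each word `u`, the words of `X` in the fiber of `u` are
covered by a language of the polynomial closure of `C` all of whose words are above `u` in the
syntactic preorder of `L`. -/
def coverable (C : Set (Language A)) (L : Language A) : Set (Set (FreeMonoid A)) :=
  {X | ∀ u : List A, ∃ K, InPol C K ∧ (∀ w ∈ X, α w = α u → w ∈ K) ∧ ∀ w ∈ K, SyntacticLE L u w}

variable {α} {C : Set (Language A)} {L : Language A} {X Y : Set (FreeMonoid A)}

theorem Recognizes.syntacticLE (hL : Recognizes α L) {u v : List A} (h : α u = α v) :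
    SyntacticLE L u v := fun x y =>
  hL _ _ (by simp only [map_append, h])

theorem exists_mem_forall_not_separable [Finite M] (hC : IsQuotientingLattice C)
    (L₁ : Language A) :
    ∃ T ∈ C, L₁ ≤ T ∧ ∀ v ∈ T, ¬Separable C L₁ (fiber α (α v)) := by
  choose K hK hle hdisj using
    fun m : {m : M // Separable C L₁ (fiber α m)} => m.2
  refine ⟨⨅ m, K m, hC.iInf_mem hK, le_iInf hle, fun v hv hsep => ?_⟩
  exact (hdisj ⟨α v, hsep⟩).le ⟨rfl, iInf_le K ⟨α v, hsep⟩ hv⟩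

theorem PolCriterion.exists_mem_syntacticLE [Finite M] (hC : IsQuotientingLattice C)
    (h : PolCriterion α C L) {u : List A} (hu : IsIdempotentElem (α u)) :
    ∃ T ∈ C, fiber α (α u) ≤ T ∧ ∀ v ∈ T, SyntacticLE L u (u ++ v ++ u) := by
  obtain ⟨T, hT, hle, hsep⟩ := exists_mem_forall_not_separable (α := α) hC (fiber α (α u))
  exact ⟨T, hT, hle, fun v hv => h u v hu (hsep v hv)⟩

theorem mem_coverable_of_map_eq (hC : IsQuotientingLattice C) (hL : Recognizes α L) {e : List A}
    (hX : ∀ w ∈ X, α w = α e) {K : Language A} (hK : InPol C K) (hXK : ∀ w ∈ X, w ∈ K)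
    (hKe : ∀ w ∈ K, SyntacticLE L e w) : X ∈ coverable α C L := by
  intro u
  by_cases h : α u = α e
  · exact ⟨K, hK, fun w hw _ => hXK w hw, fun w hw => (hL.syntacticLE h).trans (hKe w hw)⟩
  · exact ⟨⊥, .basic hC.empty_mem, fun w hw hu => h (hu ▸ hX w hw), fun w hw => hw.elim⟩

theorem coverable_mono (hX : X ∈ coverable α C L) (hYX : Y ⊆ X) : Y ∈ coverable α C L := fun u =>
  let ⟨K, hK, hXK, hKu⟩ := hX u
  ⟨K, hK, fun w hw => hXK w (hYX hw), hKu⟩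

theorem union_mem_coverable (hX : X ∈ coverable α C L) (hY : Y ∈ coverable α C L) :
    X ∪ Y ∈ coverable α C L := by
  intro u
  obtain ⟨K, hK, hXK, hKu⟩ := hX u
  obtain ⟨K', hK', hYK', hKu'⟩ := hY u
  exact ⟨K ⊔ K', .union hK hK', fun w hw hu => hw.imp (hXK w · hu) (hYK' w · hu),
    fun w hw => hw.elim (hKu w) (hKu' w)⟩

theorem mul_mem_coverable [Finite A] [Finite M] (hC : IsQuotientingLattice C)
    (hL : Recognizes α L) (hX : X ∈ coverable α C L) (hY : Y ∈ coverable α C L) :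
    X * Y ∈ coverable α C L := by
  intro u
  have hpair (p : {p : Set.range α × Set.range α // α u = p.1 * p.2}) :
      ∃ K, InPol C K ∧
        (∀ x ∈ X, ∀ y ∈ Y, α x = p.1.1 → α y = p.1.2 → x * y ∈ (K : Set (FreeMonoid A))) ∧
        ∀ w ∈ K, SyntacticLE L u w := by
    obtain ⟨⟨⟨_, x, rfl⟩, _, y, rfl⟩, hu⟩ := p
    obtain ⟨K, hK, hXK, hKx⟩ := hX x
    obtain ⟨K', hK', hYK', hKy'⟩ := hY y
    refine ⟨K * K', .mul hC hK hK',
      fun a ha b hb hax hby => Language.append_mem_mul (hXK a ha hax) (hYK' b hb hby), ?_⟩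
    rintro _ ⟨k, hk, k', hk', rfl⟩
    exact (hL.syntacticLE (hu.trans (map_mul α x y).symm)).trans
      ((hKx k hk).append (hKy' k' hk'))
  choose K hK hXY hKu using hpair
  refine ⟨⨆ p, K p, .iSup hC hK, ?_, fun w hw => ?_⟩
  · rintro _ ⟨x, hx, y, hy, rfl⟩ hu
    exact Language.mem_iSup.2 ⟨⟨(⟨α x, x, rfl⟩, ⟨α y, y, rfl⟩), hu ▸ map_mul α x y⟩,
      hXY _ x hx y hy rfl rfl⟩
  · obtain ⟨p, hp⟩ := Language.mem_iSup.1 hw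
    exact hKu p w hp

namespace PolCriterion

variable [Finite M] (hC : IsQuotientingLattice C) (hL : Recognizes α L) (h : PolCriterion α C L)
include hC hL h

theorem one_mem_coverable : 1 ∈ coverable α C L := by
  obtain ⟨T, hT, hle, hTw⟩ := h.exists_mem_syntacticLE hC (u := []) (map_one α ▸ .one)
  refine mem_coverable_of_map_eq hC hL (e := []) ?_ (.basic hT) ?_ fun w hw => ?_
  · rintro _ rfl
    rfl
  · rintro _ rfl
    exact hle rfl
  · simpa using hTw w hw

theorem singleton_of_mem_coverable (a : A) : {FreeMonoid.of a} ∈ coverable α C L := by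
  obtain ⟨T, hT, hle, hTw⟩ := h.exists_mem_syntacticLE hC (u := []) (map_one α ▸ .one)
  refine mem_coverable_of_map_eq hC hL (e := [a]) ?_ (.marked a (.basic hT) (.basic hT)) ?_ ?_
  · rintro _ rfl
    rfl
  · rintro _ rfl
    exact mem_marked.2 ⟨[], hle rfl, [], hle rfl, rfl⟩
  · intro w hw
    obtain ⟨t, ht, t', ht', rfl⟩ := mem_marked.1 hw
    have hnil {t : List A} (ht : t ∈ T) : SyntacticLE L [] t := by simpa using hTw t ht
    simpa using ((hnil ht).append (.refl L [a])).append (hnil ht')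

variable [Finite A]

theorem closure_mem_coverable {e : M} (he : IsIdempotentElem e) (hX : X ∈ coverable α C L)
    (hXe : ∀ x ∈ X, α x = e) : (Submonoid.closure X : Set (FreeMonoid A)) ∈ coverable α C L := by
  have hone := h.one_mem_coverable hC hL
  rcases X.eq_empty_or_nonempty with rfl | ⟨u, hu⟩
  · simpa [← Set.singleton_one] using hone
  obtain rfl : α u = e := hXe u hu
  obtain ⟨T, hT, hle, hTw⟩ := h.exists_mem_syntacticLE hC he
  obtain ⟨K, hK, hXK, hKu⟩ := hX u
  have hmiddle : X * α ⁻¹' {α u} * X ∈ coverable α C L := by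
    refine mem_coverable_of_map_eq hC hL (e := u) ?_ ((hK.mul hC (.basic hT)).mul hC hK) ?_ ?_
    · rintro _ ⟨_, ⟨x, hx, t, ht, rfl⟩, y, hy, rfl⟩
      rw [map_mul, map_mul, ht, hXe x hx, hXe y hy, he.eq, he.eq]
    · rintro _ ⟨_, ⟨x, hx, t, ht, rfl⟩, y, hy, rfl⟩
      exact Language.append_mem_mul (Language.append_mem_mul (hXK x hx (hXe x hx)) (hle ht))
        (hXK y hy (hXe y hy))
    · rintro _ ⟨_, ⟨k, hk, t, ht, rfl⟩, k', hk', rfl⟩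
      exact (hTw t ht).trans (((hKu k hk).append (.refl L t)).append (hKu k' hk'))
  have hXX := mul_mem_coverable hC hL hX hX
  exact coverable_mono (union_mem_coverable (union_mem_coverable (union_mem_coverable hone hX) hXX)
    hmiddle) (closure_subset_of_map_eq he hXe)

theorem isIterationIdeal_coverable : IsIterationIdeal α (coverable α C L) where
  mono := coverable_mono
  one_mem := h.one_mem_coverable hC hL
  union := union_mem_coverable
  mul := mul_mem_coverable hC hL
  iterate hX he hXe := h.closure_mem_coverable hC hL he hX hXe

theorem univ_mem_coverable : Set.univ ∈ coverable α C L := by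
  have hG := h.isIterationIdeal_coverable hC hL
  have hletters := hG.iUnion_mem (h.singleton_of_mem_coverable hC hL)
  rw [Set.iUnion_singleton_eq_range] at hletters
  simpa [FreeMonoid.closure_range_of] using hG.closure_mem hletters

theorem inPol : InPol C L := by
  have hcover (m : α '' L) : ∃ K, InPol C K ∧ fiber α m ≤ K ∧ K ≤ L := by
    obtain ⟨_, u, hu, rfl⟩ := m
    obtain ⟨K, hK, hcov, hKu⟩ := h.univ_mem_coverable hC hL u
    exact ⟨K, hK, fun w hw => hcov w trivial hw, fun w hw => (hKu w hw).mem hu⟩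
  choose K hK hcov hKL using hcover
  have hLK : L = ⨆ m, K m := le_antisymm
    (fun w hw => Language.mem_iSup.2 ⟨⟨α w, w, hw, rfl⟩, hcov _ rfl⟩) (iSup_le hKL)
  rw [hLK]
  exact .iSup hC hK

end PolCriterion

/-- The concatenation of `n` copies of `u`. -/
def repeatWord (u : List A) (n : ℕ) : List A := (List.replicate n u).flatten

theorem repeatWord_one (u : List A) : repeatWord u 1 = u := by simp [repeatWord]

theorem repeatWord_add (u : List A) (m n : ℕ) :
    repeatWord u (m + n) = repeatWord u m ++ repeatWord u n := by
  simp only [repeatWord, List.replicate_add, List.flatten_append]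

theorem map_repeatWord (α : FreeMonoid A →* M) (u : List A) (n : ℕ) :
    α (repeatWord u n) = α u ^ n := by
  induction n with
  | zero => exact (map_one α).trans (pow_zero _).symm
  | succ n ih => rw [repeatWord_add, repeatWord_one, map_append, ih, pow_succ]

/-- The two-sided quotients of `L`. -/
def quotients (L : Language A) : Set (Language A) :=
  Set.range fun p : List A × List A => rightQuotient (L.leftQuotient p.1) p.2

theorem finite_quotients (hL : L.IsRegular) : (quotients L).Finite := by
  obtain ⟨σ, _, D, rfl⟩ := hL
  refine (Set.finite_range fun p : σ × Set σ =>
    ({w | D.evalFrom p.1 w ∈ p.2} : Language A)).subset ?_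
  rintro _ ⟨⟨x, y⟩, rfl⟩
  refine ⟨(D.eval x, {q | D.evalFrom q y ∈ D.accept}), ?_⟩
  ext w
  change D.evalFrom (D.evalFrom (D.evalFrom D.start x) w) y ∈ D.accept ↔
    D.evalFrom D.start (x ++ (w ++ y)) ∈ D.accept
  rw [DFA.evalFrom_of_append, DFA.evalFrom_of_append]

theorem IsQuotientingLattice.quotients_subset (hC : IsQuotientingLattice C) (hL : L ∈ C) :
    quotients L ⊆ C := by
  rintro _ ⟨⟨x, y⟩, rfl⟩
  exact hC.rightQuotient_mem _ (hC.leftQuotient_mem _ hL x) y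

/-- The pumping property that is used for the languages of a polynomial closure: in a factor `uⁿ`
with `n ≥ N` of a word of `L`, one can insert `v` and change the exponents on both sides to some
positive ones without leaving `L`, provided that `v` belongs to all the languages of `D` that
contain `u`. -/
def AllowsSubstitution (D : Set (Language A)) (N : ℕ) (L : Language A) : Prop :=
  ∀ u v, (∀ K ∈ D, u ∈ K → v ∈ K) → ∀ n ≥ N, ∀ x y, x ++ repeatWord u n ++ y ∈ L →
    ∃ k k', x ++ repeatWord u (k + 1) ++ v ++ repeatWord u (k' + 1) ++ y ∈ L

namespace AllowsSubstitution

variable {D D' : Set (Language A)} {N N' : ℕ} {H : Language A}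

theorem mono (h : AllowsSubstitution D N L) (hD : D ⊆ D') (hN : N ≤ N') :
    AllowsSubstitution D' N' L :=
  fun u v huv n hn => h u v (fun K hK => huv K (hD hK)) n (hN.trans hn)

theorem of_quotients (L : Language A) : AllowsSubstitution (quotients L) 3 L := by
  intro u v huv n hn x y h
  obtain ⟨n, rfl⟩ := Nat.exists_eq_add_of_le hn
  have hu : u ∈ rightQuotient (L.leftQuotient (x ++ u)) (repeatWord u (n + 1) ++ y) := by
    change x ++ u ++ (u ++ (repeatWord u (n + 1) ++ y)) ∈ L
    rw [show 3 + n = 1 + (1 + (n + 1)) by omega, repeatWord_add, repeatWord_add,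
      repeatWord_one] at h
    simpa only [List.append_assoc] using h
  have hv : x ++ u ++ (v ++ (repeatWord u (n + 1) ++ y)) ∈ L := huv _ ⟨(x ++ u, _), rfl⟩ hu
  refine ⟨0, n, ?_⟩
  rw [zero_add, repeatWord_one]
  simpa only [List.append_assoc] using hv

theorem sup (hH : AllowsSubstitution D N H) (hL : AllowsSubstitution D N L) :
    AllowsSubstitution D N (H ⊔ L) := by
  rintro u v huv n hn x y (h | h)
  · obtain ⟨k, k', hk⟩ := hH u v huv n hn x y h
    exact ⟨k, k', Or.inl hk⟩
  · obtain ⟨k, k', hk⟩ := hL u v huv n hn x y h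
    exact ⟨k, k', Or.inr hk⟩

theorem marked (a : A) (hH : AllowsSubstitution D N H) (hL : AllowsSubstitution D N' L) :
    AllowsSubstitution D (N + N') (H * {[a]} * L) := by
  intro u v huv n hn x y h
  obtain ⟨n, rfl⟩ := Nat.exists_eq_add_of_le hn
  rw [add_assoc, repeatWord_add, ← List.append_assoc, List.append_assoc, append_mem_marked] at h
  -- Either the first `N` copies of `u` lie in `H`, or the remaining ones lie in `L`.
  rcases h with ⟨z, t, hz, ht, hzt⟩ | ⟨s, z, hs, hz, hsz⟩
  · obtain ⟨k, k', hk⟩ := hH u v huv N le_rfl x z hz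
    refine ⟨k, k' + (N' + n), mem_marked.2 ⟨_, hk, t, ht, ?_⟩⟩
    rw [add_right_comm, repeatWord_add _ (k' + 1)]
    simp only [List.append_assoc, hzt]
  · rw [← List.append_assoc] at hz
    obtain ⟨k, k', hk⟩ := hL u v huv (N' + n) (Nat.le_add_right _ _) z y hz
    refine ⟨N + k, k', mem_marked.2 ⟨s, hs, _, hk, ?_⟩⟩
    rw [add_assoc N, repeatWord_add, ← List.append_assoc x, hsz]
    simp only [List.append_assoc, List.cons_append]

end AllowsSubstitution

theorem InPol.exists_finite_allowsSubstitution (hC : IsQuotientingLattice C) (hL : InPol C L) :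
    ∃ D ⊆ C, D.Finite ∧ ∃ N, AllowsSubstitution D N L := by
  induction hL with
  | basic hL =>
    exact ⟨_, hC.quotients_subset hL, finite_quotients (hC.regular _ hL), 3, .of_quotients _⟩
  | union _ _ ihH ihL =>
    obtain ⟨D, hDC, hD, N, h⟩ := ihH
    obtain ⟨D', hDC', hD', N', h'⟩ := ihL
    exact ⟨D ∪ D', Set.union_subset hDC hDC', hD.union hD', max N N',
      (h.mono Set.subset_union_left (le_max_left _ _)).sup
        (h'.mono Set.subset_union_right (le_max_right _ _))⟩
  | marked a _ _ ihH ihL =>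
    obtain ⟨D, hDC, hD, N, h⟩ := ihH
    obtain ⟨D', hDC', hD', N', h'⟩ := ihL
    exact ⟨D ∪ D', Set.union_subset hDC hDC', hD.union hD', N + N',
      .marked a (h.mono Set.subset_union_left le_rfl) (h'.mono Set.subset_union_right le_rfl)⟩

theorem exists_of_not_separable (hC : IsQuotientingLattice C) {L₁ L₂ : Language A}
    (h : ¬Separable C L₁ L₂) {D : Set (Language A)} (hDC : D ⊆ C) (hD : D.Finite) :
    ∃ u ∈ L₁, ∃ v ∈ L₂, ∀ K ∈ D, u ∈ K → v ∈ K := by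
  by_contra! hcon
  have := hD.to_subtype
  let types : Set (Set D) := (fun u => {K : D | u ∈ K.1}) '' L₁
  refine h ⟨⨆ E : types, ⨅ K : E.1, K.1.1,
    hC.iSup_mem fun E => hC.iInf_mem fun K => hDC K.1.2, fun u hu => ?_, ?_⟩
  · exact Language.mem_iSup.2 ⟨⟨_, u, hu, rfl⟩, mem_iInf.2 fun K => K.2⟩
  · refine le_bot_iff.1 fun v hv => ?_
    obtain ⟨⟨_, u, hu, rfl⟩, hE⟩ := Language.mem_iSup.1 hv.2
    obtain ⟨K, hK, huK, hvK⟩ := hcon u hu v hv.1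
    exact (hvK (mem_iInf.1 hE ⟨⟨K, hK⟩, huK⟩)).elim

theorem InPol.polCriterion (h : InPol C L) (hC : IsQuotientingLattice C) (hL : Recognizes α L) :
    PolCriterion α C L := by
  intro u v hu hsep x y hxy
  obtain ⟨D, hDC, hD, N, hN⟩ := h.exists_finite_allowsSubstitution hC
  obtain ⟨u', hu', v', hv', huv⟩ := exists_of_not_separable hC hsep hDC hD
  have hpow (n : ℕ) : α (repeatWord u' (n + 1)) = α u := by
    rw [map_repeatWord, hu', hu.pow_succ_eq]
  obtain ⟨k, k', hk⟩ := hN u' v' huv (N + 1) (Nat.le_succ N) x y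
    (hL _ _ (by simp only [map_append, hpow]) hxy)
  exact hL _ _ (by simp only [map_append, hpow, show α v' = α v from hv', mul_assoc]) hk

theorem mem_pol_iff_polCriterion [Finite A] [Finite M] (hC : IsQuotientingLattice C)
    (hL : Recognizes α L) : L ∈ Pol C ↔ PolCriterion α C L :=
  ⟨fun h => InPol.polCriterion h hC hL, fun h => h.inPol hC hL⟩

end Criterion

section Computability

variable {β γ : Type*} [Primcodable β] [Primcodable γ]

theorem computablePred_comp {p : γ → Prop} (hp : ComputablePred p) {f : β → γ}
    (hf : Computable f) : ComputablePred fun b => p (f b) := by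
  obtain ⟨g, hg, rfl⟩ := ComputablePred.computable_iff.1 hp
  exact ComputablePred.computable_iff.2 ⟨_, hg.comp hf, rfl⟩

theorem computablePred_or {p q : β → Prop} (hp : ComputablePred p) (hq : ComputablePred q) :
    ComputablePred fun b => p b ∨ q b := by
  classical
  refine ComputablePred.computable_iff.2
    ⟨_, Primrec.or.to_comp.comp hp.decide hq.decide, funext fun b => ?_⟩
  simp

theorem computablePred_forall_lt {n : β → ℕ} (hn : Computable n) {p : β → ℕ → Prop}
    (hp : ComputablePred fun z : β × ℕ => p z.1 z.2) :
    ComputablePred fun b => ∀ i < n b, p b i := by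
  classical
  let check (b : β) (k : ℕ) : Bool := k.rec true fun i r => r && decide (p b i)
  have hcheck (b : β) (k : ℕ) : check b k = true ↔ ∀ i < k, p b i := by
    induction k with
    | zero => simp [check]
    | succ k ih =>
      rw [show check b (k + 1) = (check b k && decide (p b k)) from rfl, Bool.and_eq_true, ih,
        decide_eq_true_eq, Nat.forall_lt_succ_right]
  have hcomp : Computable fun b => check b (n b) :=
    Computable.nat_rec (h := fun b (z : ℕ × Bool) => z.2 && decide (p b z.1)) hn
      (Computable.const true) <| Primrec.and.to_comp.comp (Computable.snd.comp Computable.snd)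
        (hp.decide.comp (Computable.pair Computable.fst (Computable.fst.comp Computable.snd)))
  exact ComputablePred.computable_iff.2 ⟨_, hcomp, funext fun b => propext (hcheck b (n b)).symm⟩

theorem computablePred_forall_mem_option {o : β → Option γ} (ho : Computable o)
    {p : β → γ → Prop} (hp : ComputablePred fun z : β × γ => p z.1 z.2) :
    ComputablePred fun b => ∀ c ∈ o b, p b c := by
  classical
  refine ComputablePred.computable_iff.2 ⟨_, Computable.option_casesOn
    (g := fun b c => decide (p b c)) ho (Computable.const true) hp.decide, funext fun b => ?_⟩
  cases o b <;> simp

theorem computablePred_forall_mem_list {l : β → List γ} (hl : Computable l)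
    {p : β → γ → Prop} (hp : ComputablePred fun z : β × γ => p z.1 z.2) :
    ComputablePred fun b => ∀ c ∈ l b, p b c := by
  have hentry : ComputablePred fun z : β × ℕ => ∀ c ∈ (l z.1)[z.2]?, p z.1 c :=
    computablePred_forall_mem_option
      (Computable.list_getElem?.comp (hl.comp Computable.fst) Computable.snd)
      (computablePred_comp hp
        (Computable.pair (Computable.fst.comp Computable.fst) Computable.snd))
  refine (computablePred_forall_lt (p := fun b i => ∀ c ∈ (l b)[i]?, p b c)
    (Computable.list_length.comp hl) hentry).of_eq fun b => ?_
  constructor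
  · intro h c hc
    obtain ⟨i, hi, rfl⟩ := List.mem_iff_getElem.1 hc
    exact h i hi _ (List.getElem?_eq_getElem hi)
  · exact fun h i _ c hc => h c (List.mem_of_getElem? hc)

variable {l : β → List γ} {R : β → γ → Prop}

theorem primrecPred_forall_mem_list (hl : Primrec l) (hR : PrimrecRel R) :
    PrimrecPred fun b => ∀ c ∈ l b, R b c :=
  hR.swap.forall_mem_list.comp hl Primrec.id

theorem primrecPred_exists_mem_list (hl : Primrec l) (hR : PrimrecRel R) :
    PrimrecPred fun b => ∃ c ∈ l b, R b c :=
  hR.swap.exists_mem_list.comp hl Primrec.id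

theorem primrecRel_mem_list : PrimrecRel fun (c : γ) (l : List γ) => c ∈ l :=
  (primrecPred_exists_mem_list (R := fun (z : γ × List γ) d => d = z.1) Primrec.snd
    (Primrec.eq.comp Primrec.snd (Primrec.fst.comp Primrec.fst))).of_eq fun z => by simp

theorem primrec_list_product {l₁ l₂ : β → List γ} (h₁ : Primrec l₁)
    (h₂ : Primrec l₂) : Primrec fun b => l₁ b ×ˢ l₂ b :=
  Primrec.list_flatMap h₁ <| Primrec.list_map (h₂.comp Primrec.fst) <|
    Primrec.pair (Primrec.snd.comp Primrec.fst) Primrec.snd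

theorem primrec_two_pow : Primrec fun n : ℕ => 2 ^ n :=
  (Primrec.nat_rec₁ 1 (f := fun _ r => r + r)
    (Primrec.nat_add.comp Primrec.snd Primrec.snd)).of_eq fun n => by
      induction n with
      | zero => rfl
      | succ n ih => rw [pow_succ, ← ih, mul_two]

end Computability

section ShortWords

variable {M : Type*} [Monoid M] [Finite M]

theorem exists_length_le_map_eq (α : FreeMonoid A →* M) (u : List A) :
    ∃ v : List A, v.length ≤ Nat.card M ∧ α v = α u := by
  have := Fintype.ofFinite M
  let D : DFA A M := ⟨fun m a => m * α (FreeMonoid.of a), 1, ∅⟩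
  have hD (w : List A) : ∀ m, D.evalFrom m w = m * α w := by
    induction w with
    | nil => exact fun m => ((congrArg (m * ·) (map_one α)).trans (mul_one m)).symm
    | cons a w ih =>
      intro m
      rw [DFA.evalFrom_cons, ih]
      exact (mul_assoc _ _ _).trans (congrArg (m * ·) (map_append α [a] w).symm)
  induction hn : u.length using Nat.strong_induction_on generalizing u with
  | _ n ih =>
  rcases le_total u.length (Nat.card M) with h | h
  · exact ⟨u, h, rfl⟩
  rw [Nat.card_eq_fintype_card] at h
  obtain ⟨q, a, b, c, rfl, -, hb, ha, hq, hc⟩ := D.evalFrom_split h (s := 1) rfl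
  have hlt : (a ++ c).length < n := by
    have := List.length_pos_iff.2 hb
    simp only [List.length_append] at hn ⊢
    lia
  obtain ⟨v, hv, hvac⟩ := ih _ hlt _ rfl
  rw [hD, one_mul] at ha
  rw [hD] at hq
  exact ⟨v, hv, by rw [hvac, map_append, map_append, map_append, ha, hq]⟩

/-- All words of length at most `n` over the letters in `l`. -/
def shortWords (l : List A) (n : ℕ) : List (List A) :=
  n.rec [[]] fun _ W => [] :: W.flatMap fun w => l.map fun a => a :: w

theorem mem_shortWords {l : List A} (hl : ∀ a, a ∈ l) {n : ℕ} {w : List A}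
    (hw : w.length ≤ n) : w ∈ shortWords l n := by
  induction n generalizing w with
  | zero =>
    obtain rfl : w = [] := List.length_eq_zero_iff.1 (Nat.le_zero.1 hw)
    exact List.mem_singleton.2 rfl
  | succ n ih =>
    rcases w with _ | ⟨a, w⟩
    · exact List.mem_cons_self
    · exact List.mem_cons_of_mem _ (List.mem_flatMap.2
        ⟨w, ih (Nat.le_of_succ_le_succ hw), List.mem_map.2 ⟨a, hl a, rfl⟩⟩)

theorem primrec_shortWords [Primcodable A] (l : List A) : Primrec (shortWords l) :=
  Primrec.nat_rec₁ _ <| Primrec.list_cons.comp (Primrec.const []) <|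
    Primrec.list_flatMap Primrec.snd <| Primrec.list_map (Primrec.const l) <|
      Primrec.list_cons.comp Primrec.snd (Primrec.snd.comp Primrec.fst)

variable (A) in
/-- A list of all the letters of a finite alphabet. -/
noncomputable def letters [Finite A] : List A := (Set.finite_univ (α := A)).toFinset.toList

theorem mem_letters [Finite A] (a : A) : a ∈ letters A := by
  simp [letters]

end ShortWords

namespace Automaton

variable (M : Automaton A) {S : List ℕ} {q : ℕ} {u v : List A}

/-- The states that `M` can reach from the states in `S` by reading `u`, as a list. This is the
computable counterpart of `NFA.evalFrom`. -/
def run [DecidableEq A] (S : List ℕ) (u : List A) : List ℕ :=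
  u.foldl (fun S a => (M.2.1.filter fun t => t.1 ∈ S ∧ t.2.1 = a).map fun t => t.2.2) S

/-- The initial states and the targets of the transitions. Every run from one of these states ends
in one of them. -/
def states : List ℕ := M.1 ++ M.2.1.map fun t => t.2.2

section TransitionMonoid

variable [DecidableEq A]

theorem mem_run : q ∈ M.run S u ↔ q ∈ M.toNFA.evalFrom {p | p ∈ S} u := by
  induction u generalizing S with
  | nil => rfl
  | cons a u ih =>
    rw [NFA.evalFrom_cons, run, List.foldl_cons, ← run, ih]
    suffices h : {q | q ∈ (M.2.1.filter fun t => t.1 ∈ S ∧ t.2.1 = a).map fun t => t.2.2} =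
        M.toNFA.stepSet {p | p ∈ S} a by rw [h]
    ext q
    simp only [Set.mem_ofPred_eq, List.mem_map, List.mem_filter, NFA.mem_stepSet,
      decide_eq_true_eq]
    constructor
    · rintro ⟨⟨p, _, q⟩, ⟨ht, hp, rfl⟩, rfl⟩
      exact ⟨p, hp, ht⟩
    · rintro ⟨p, hp, ht⟩
      exact ⟨(p, a, q), ⟨ht, hp, rfl⟩, rfl⟩

theorem mem_run_iff_exists : q ∈ M.run S u ↔ ∃ p ∈ S, q ∈ M.run [p] u := by
  simp only [mem_run, List.mem_singleton, Set.ofPred_eq_eq_singleton]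
  exact NFA.mem_evalFrom_iff_exists

theorem mem_language_iff : u ∈ M.language ↔ ∃ q ∈ M.run M.1 u, q ∈ M.2.2 := by
  simp only [mem_run]
  exact exists_congr fun q => and_comm

theorem run_subset_states (hS : S ⊆ M.states) : M.run S u ⊆ M.states := by
  induction u generalizing S with
  | nil => exact hS
  | cons a _ ih =>
    refine ih fun q hq => List.mem_append_right _ ?_
    obtain ⟨t, ht, rfl⟩ := List.mem_map.1 hq
    exact List.mem_map.2 ⟨t, List.mem_of_mem_filter ht, rfl⟩

/-- The Boolean matrix of the relation that `u` induces on the states of `M`, written as a list. It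
serves as a computable name of the image of `u` in the transition monoid. -/
def transitionTable (u : List A) : List Bool :=
  (M.states ×ˢ M.states).map fun z => decide (z.2 ∈ M.run [z.1] u)

theorem transitionTable_eq_iff : M.transitionTable u = M.transitionTable v ↔
    ∀ p q, p ∈ M.states → q ∈ M.states → (q ∈ M.run [p] u ↔ q ∈ M.run [p] v) := by
  simp only [transitionTable, List.map_inj_left, decide_eq_decide, Prod.forall,
    List.mem_product, and_imp]

theorem mem_run_append {p : ℕ} (hp : p ∈ M.states) :
    q ∈ M.run [p] (u ++ v) ↔ ∃ r ∈ M.states, r ∈ M.run [p] u ∧ q ∈ M.run [r] v := by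
  have hsub : M.run [p] u ⊆ M.states := M.run_subset_states (by simpa using hp)
  rw [run, List.foldl_append, ← run, ← run, mem_run_iff_exists]
  exact ⟨fun ⟨r, hr, hq⟩ => ⟨r, hsub hr, hr, hq⟩, fun ⟨r, _, hr, hq⟩ => ⟨r, hr, hq⟩⟩

/-- The congruence on words whose quotient is the transition monoid of `M`. -/
def transitionCon : Con (FreeMonoid A) where
  toSetoid := Setoid.ker M.transitionTable
  mul' {u u' v v'} hu hv := by
    refine M.transitionTable_eq_iff.2 fun p q hp hq => ?_
    refine (M.mem_run_append hp).trans (Iff.trans ?_ (M.mem_run_append hp).symm)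
    refine exists_congr fun r => and_congr_right fun hr => and_congr ?_ ?_
    · exact M.transitionTable_eq_iff.1 hu p r hp hr
    · exact M.transitionTable_eq_iff.1 hv r q hr hq

/-- The morphism from words to the transition monoid of `M`. -/
def transitionHom : FreeMonoid A →* M.transitionCon.Quotient := M.transitionCon.mk'

theorem transitionHom_eq_iff :
    M.transitionHom u = M.transitionHom v ↔ M.transitionTable u = M.transitionTable v :=
  M.transitionCon.eq

theorem recognizes_transitionHom : Recognizes M.transitionHom M.language := by
  intro u v huv
  rw [transitionHom_eq_iff, transitionTable_eq_iff] at huv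
  simp only [mem_language_iff, M.mem_run_iff_exists (S := M.1)]
  rintro ⟨q, ⟨p, hp, hpq⟩, hq⟩
  have hps : p ∈ M.states := List.mem_append_left _ hp
  have hqs : q ∈ M.states := M.run_subset_states (by simpa using hps) hpq
  exact ⟨q, ⟨p, hp, (huv p q hps hqs).1 hpq⟩, hq⟩

/-- An upper bound for the size of the transition monoid. -/
def sizeBound : ℕ := 2 ^ (M.states.length * M.states.length)

theorem exists_injective_quotient_vector :
    ∃ f : M.transitionCon.Quotient → List.Vector Bool (M.states.length * M.states.length),
      f.Injective := by
  have hlength (u : List A) : (M.transitionTable u).length = M.states.length * M.states.length := by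
    simp only [transitionTable, List.length_map, List.length_product]
  refine ⟨Quotient.lift (fun u => ⟨M.transitionTable u, hlength u⟩)
    fun u v h => Subtype.ext h, fun x y => Quotient.inductionOn₂ x y fun u v h => ?_⟩
  exact Quotient.sound (congrArg Subtype.val h)

instance : Finite M.transitionCon.Quotient := by
  obtain ⟨f, hf⟩ := M.exists_injective_quotient_vector
  exact Finite.of_injective f hf

theorem card_transitionMonoid_le : Nat.card M.transitionCon.Quotient ≤ M.sizeBound := by
  obtain ⟨f, hf⟩ := M.exists_injective_quotient_vector
  simpa [sizeBound] using Nat.card_le_card_of_injective f hf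

end TransitionMonoid

/-- Words that represent all the elements of the transition monoid of `M`. -/
noncomputable def representatives [Finite A] (M : Automaton A) : List (List A) :=
  shortWords (letters A) M.sizeBound

theorem exists_mem_representatives [Finite A] [DecidableEq A] (u : List A) :
    ∃ v ∈ M.representatives, M.transitionHom v = M.transitionHom u := by
  obtain ⟨v, hv, hvu⟩ := exists_length_le_map_eq M.transitionHom u
  exact ⟨v, mem_shortWords mem_letters (hv.trans M.card_transitionMonoid_le), hvu⟩

/-- A deterministic automaton for the fiber of the image of `u` in the transition monoid of `M`. Its
states are the codes of the elements of that monoid, on which letters act by right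
multiplication. -/
noncomputable def fiberAutomaton [Finite A] [DecidableEq A] (M : Automaton A) (u : List A) :
    Automaton A :=
  ([Encodable.encode (M.transitionTable [])],
    M.representatives.flatMap fun w => (letters A).map fun a =>
      (Encodable.encode (M.transitionTable w), a, Encodable.encode (M.transitionTable (w ++ [a]))),
    [Encodable.encode (M.transitionTable u)])

section FiberAutomaton

variable [Finite A]

theorem syntacticLE_iff_representatives : SyntacticLE M.language u v ↔
    ∀ x ∈ M.representatives, ∀ y ∈ M.representatives,
      x ++ u ++ y ∉ M.language ∨ x ++ v ++ y ∈ M.language := by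
  classical
  refine ⟨fun h x _ y _ => not_or_of_imp (h x y), fun h x y hxy => ?_⟩
  obtain ⟨x', hx'M, hx'⟩ := M.exists_mem_representatives x
  obtain ⟨y', hy'M, hy'⟩ := M.exists_mem_representatives y
  have hiff (w : List A) : x' ++ w ++ y' ∈ M.language ↔ x ++ w ++ y ∈ M.language := by
    have heq : M.transitionHom (x' ++ w ++ y' : List A) =
        M.transitionHom (x ++ w ++ y : List A) := by simp only [map_append, hx', hy']
    exact ⟨M.recognizes_transitionHom _ _ heq, M.recognizes_transitionHom _ _ heq.symm⟩
  have hxy' := h x' hx'M y' hy'M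
  rw [hiff, hiff] at hxy'
  exact hxy'.resolve_left (not_not.2 hxy)

variable [DecidableEq A]

theorem stepSet_fiberAutomaton (u z : List A) (a : A) :
    (M.fiberAutomaton u).toNFA.stepSet {Encodable.encode (M.transitionTable z)} a =
      {Encodable.encode (M.transitionTable (z ++ [a]))} := by
  have hstep (q : ℕ) :
      q ∈ (M.fiberAutomaton u).toNFA.step (Encodable.encode (M.transitionTable z)) a ↔
        ∃ w ∈ M.representatives, M.transitionHom w = M.transitionHom z ∧
          Encodable.encode (M.transitionTable (w ++ [a])) = q := by
    change (_, a, q) ∈ (M.fiberAutomaton u).2.1 ↔ _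
    simp [fiberAutomaton, mem_letters, transitionHom_eq_iff]
  have hcongr {w : List A} (hw : M.transitionHom w = M.transitionHom z) :
      M.transitionTable (w ++ [a]) = M.transitionTable (z ++ [a]) :=
    M.transitionHom_eq_iff.1 (by simp only [map_append, hw])
  ext q
  rw [NFA.stepSet_singleton, hstep, Set.mem_singleton_iff]
  constructor
  · rintro ⟨w, -, hw, rfl⟩
    rw [hcongr hw]
  · rintro rfl
    obtain ⟨w, hwM, hw⟩ := M.exists_mem_representatives z
    exact ⟨w, hwM, hw, by rw [hcongr hw]⟩

theorem eval_fiberAutomaton (u z : List A) :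
    (M.fiberAutomaton u).toNFA.eval z = {Encodable.encode (M.transitionTable z)} := by
  induction z using List.reverseRecOn with
  | nil =>
    ext q
    exact List.mem_singleton
  | append_singleton z a ih => rw [NFA.eval_append_singleton, ih, stepSet_fiberAutomaton]

theorem language_fiberAutomaton (u : List A) :
    (M.fiberAutomaton u).language = fiber M.transitionHom (M.transitionHom u) := by
  ext z
  change (∃ q ∈ [Encodable.encode (M.transitionTable u)], q ∈ (M.fiberAutomaton u).toNFA.eval z) ↔
    M.transitionHom z = M.transitionHom u
  rw [eval_fiberAutomaton, transitionHom_eq_iff]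
  simp [eq_comm]

theorem polCriterion_iff_representatives (C : Set (Language A)) :
    PolCriterion M.transitionHom C M.language ↔
      ∀ u ∈ M.representatives, ∀ v ∈ M.representatives,
        (M.transitionTable (u ++ u) ≠ M.transitionTable u ∨
            SyntacticLE M.language u (u ++ v ++ u)) ∨
          Separable C (M.fiberAutomaton u).language (M.fiberAutomaton v).language := by
  simp only [language_fiberAutomaton, ne_eq, ← transitionHom_eq_iff]
  constructor
  · intro h u _ v _
    by_contra! hcon
    exact hcon.1.2 (h u v ((map_append _ u u).symm.trans hcon.1.1) hcon.2)
  · intro h u v hu hsep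
    obtain ⟨u', hu'M, hu'⟩ := M.exists_mem_representatives u
    obtain ⟨v', hv'M, hv'⟩ := M.exists_mem_representatives v
    have hidem : M.transitionHom (u' ++ u' : List A) = M.transitionHom u' := by
      simp only [map_append, hu', hu.eq]
    have hle : SyntacticLE M.language u' (u' ++ v' ++ u') := by
      simpa only [hidem, not_true, false_or, hu', hv', hsep, or_false] using h u' hu'M v' hv'M
    have hrec := M.recognizes_transitionHom
    exact (hrec.syntacticLE hu'.symm).trans
      (hle.trans (hrec.syntacticLE (by simp only [map_append, hu', hv'])))

end FiberAutomaton

end Automaton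

section Decidability

variable [Primcodable A]

namespace Automaton

theorem primrec_states : Primrec (states : Automaton A → List ℕ) :=
  Primrec.list_append.comp Primrec.fst <| Primrec.list_map (Primrec.fst.comp Primrec.snd) <|
    (Primrec.snd.comp Primrec.snd).comp Primrec.snd

theorem primrec_sizeBound : Primrec (sizeBound : Automaton A → ℕ) :=
  have hlength : Primrec fun M : Automaton A => M.states.length :=
    Primrec.list_length.comp primrec_states
  primrec_two_pow.comp (Primrec.nat_mul.comp hlength hlength)

theorem primrec_representatives [Finite A] :
    Primrec (representatives : Automaton A → List (List A)) :=
  (primrec_shortWords _).comp primrec_sizeBound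

variable {β : Type*} [Primcodable β] {M : β → Automaton A} {u v : β → List A}

section DecidableEq

variable [DecidableEq A]

theorem primrec_run {S : β → List ℕ} (hM : Primrec M) (hS : Primrec S) (hu : Primrec u) :
    Primrec fun b => (M b).run (S b) (u b) := by
  have henabled : PrimrecRel fun (t : ℕ × A × ℕ) (z : List ℕ × A) => t.1 ∈ z.1 ∧ t.2.1 = z.2 :=
    (primrecRel_mem_list.comp (Primrec.fst.comp Primrec.fst)
      (Primrec.fst.comp Primrec.snd)).and
    (Primrec.eq.comp (Primrec.fst.comp (Primrec.snd.comp Primrec.fst))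
      (Primrec.snd.comp Primrec.snd))
  refine Primrec.list_foldl hu hS (h := fun b (z : List ℕ × A) =>
    ((M b).2.1.filter fun t => t.1 ∈ z.1 ∧ t.2.1 = z.2).map fun t => t.2.2) ?_
  refine Primrec.list_map (henabled.listFilter.comp ?_ Primrec.snd) ?_
  · exact Primrec.fst.comp (Primrec.snd.comp (hM.comp Primrec.fst))
  · exact (Primrec.snd.comp Primrec.snd).comp Primrec.snd

theorem primrec_transitionTable (hM : Primrec M) (hu : Primrec u) :
    Primrec fun b => (M b).transitionTable (u b) := by
  have hstates := primrec_states.comp hM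
  refine Primrec.list_map (primrec_list_product hstates hstates) ?_
  refine (primrecRel_mem_list.comp (Primrec.snd.comp Primrec.snd) ?_).decide
  exact primrec_run (hM.comp Primrec.fst)
    (Primrec.list_cons.comp (Primrec.fst.comp Primrec.snd) (Primrec.const []))
    (hu.comp Primrec.fst)

theorem primrec_fiberAutomaton [Finite A] (hM : Primrec M) (hu : Primrec u) :
    Primrec fun b => (M b).fiberAutomaton (u b) := by
  refine Primrec.pair ?_ (Primrec.pair ?_ ?_)
  · exact Primrec.list_cons.comp
      (Primrec.encode.comp (primrec_transitionTable hM (Primrec.const []))) (Primrec.const [])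
  · refine Primrec.list_flatMap (primrec_representatives.comp hM) ?_
    refine Primrec.list_map (Primrec.const (letters A)) ?_
    have hw : Primrec fun z : (β × List A) × A => z.1.2 := Primrec.snd.comp Primrec.fst
    have hMz : Primrec fun z : (β × List A) × A => M z.1.1 :=
      hM.comp (Primrec.fst.comp Primrec.fst)
    exact Primrec.pair (Primrec.encode.comp (primrec_transitionTable hMz hw)) <|
      Primrec.pair Primrec.snd <| Primrec.encode.comp <|
        primrec_transitionTable hMz (Primrec.list_concat.comp hw Primrec.snd)
  · exact Primrec.list_cons.comp
      (Primrec.encode.comp (primrec_transitionTable hM hu)) (Primrec.const [])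

end DecidableEq

theorem primrecPred_mem_language (hM : Primrec M) (hu : Primrec u) :
    PrimrecPred fun b => u b ∈ (M b).language := by
  classical
  have hrun := primrec_run hM (Primrec.fst.comp hM) hu
  refine (primrecPred_exists_mem_list (R := fun b q => q ∈ (M b).2.2) hrun ?_).of_eq
    fun b => (M b).mem_language_iff.symm
  exact primrecRel_mem_list.comp Primrec.snd
    (Primrec.snd.comp (Primrec.snd.comp (hM.comp Primrec.fst)))

theorem primrecPred_syntacticLE [Finite A] (hM : Primrec M) (hu : Primrec u) (hv : Primrec v) :
    PrimrecPred fun b => SyntacticLE (M b).language (u b) (v b) := by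
  have hreps := primrec_representatives.comp hM
  refine PrimrecPred.of_eq ?_ fun b => (M b).syntacticLE_iff_representatives.symm
  refine primrecPred_forall_mem_list hreps
    (primrecPred_forall_mem_list (hreps.comp Primrec.fst) ?_)
  have hb : Primrec fun z : (β × List A) × List A => z.1.1 := Primrec.fst.comp Primrec.fst
  have hmem {w : β → List A} (hw : Primrec w) :
      PrimrecPred fun z : (β × List A) × List A => z.1.2 ++ w z.1.1 ++ z.2 ∈ (M z.1.1).language :=
    primrecPred_mem_language (hM.comp hb) <| Primrec.list_append.comp
      (Primrec.list_append.comp (Primrec.snd.comp Primrec.fst) (hw.comp hb)) Primrec.snd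
  exact (hmem hu).not.or (hmem hv)

theorem computablePred_separable_fiberAutomaton [Finite A] [DecidableEq A] {C : Set (Language A)}
    (hsep : SeparationDecidable C) (hM : Primrec M) (hu : Primrec u) (hv : Primrec v) :
    ComputablePred fun b => Separable C ((M b).fiberAutomaton (u b)).language
      ((M b).fiberAutomaton (v b)).language :=
  computablePred_comp
    (f := fun b => ((M b).fiberAutomaton (u b), (M b).fiberAutomaton (v b))) hsep
    (Primrec.pair (primrec_fiberAutomaton hM hu) (primrec_fiberAutomaton hM hv)).to_comp

end Automaton

theorem computablePred_polCriterion [Finite A] [DecidableEq A] {C : Set (Language A)}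
    (hsep : SeparationDecidable C) :
    ComputablePred fun M : Automaton A => PolCriterion M.transitionHom C M.language := by
  have hreps : Computable (Automaton.representatives : Automaton A → List (List A)) :=
    Automaton.primrec_representatives.to_comp
  refine ComputablePred.of_eq ?_ fun M => (M.polCriterion_iff_representatives C).symm
  refine computablePred_forall_mem_list hreps
    (computablePred_forall_mem_list (hreps.comp Computable.fst) ?_)
  have hM : Primrec fun z : (Automaton A × List A) × List A => z.1.1 :=
    Primrec.fst.comp Primrec.fst
  have hu : Primrec fun z : (Automaton A × List A) × List A => z.1.2 :=
    Primrec.snd.comp Primrec.fst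
  have hv : Primrec fun z : (Automaton A × List A) × List A => z.2 := Primrec.snd
  have huu := Primrec.list_append.comp hu hu
  have huvu := Primrec.list_append.comp (Primrec.list_append.comp hu hv) hu
  have hidem := Primrec.eq.comp (Automaton.primrec_transitionTable hM huu)
    (Automaton.primrec_transitionTable hM hu)
  exact computablePred_or
    (hidem.not.or (Automaton.primrecPred_syntacticLE hM hu huvu)).computablePred
    (Automaton.computablePred_separable_fiberAutomaton hsep hM hu hv)

end Decidability

end PolClosure

theorem mainTheorem2 {A : Type*} [Finite A] [Primcodable A] (C : Set (Language A))
    (hC : PolClosure.IsQuotientingLattice C) (hsep : PolClosure.SeparationDecidable C) :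
    PolClosure.MembershipDecidable (PolClosure.Pol C) := by
  classical
  exact (PolClosure.computablePred_polCriterion hsep).of_eq fun M =>
    (PolClosure.mem_pol_iff_polCriterion hC M.recognizes_transitionHom).symm
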